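/- Cayley's formula. Let $n\ge 1$ and let $\Pi_n$ be the complete graph on $n$ vertices, i.e. the graph in which every two distinct vertices are joined by exactly one edge and which has no loops. Let $\tau(\Pi_n)$ be the number of its spanning trees, i.e. of its connected acyclic subgraphs containing all $n$ vertices (the vertices being distinguishable). Number the vertices $1,\dots,n$ in any way, and let $K$ be the Kirchhoff minor of $\Pi_n$: the $(n-1)\times(n-1)$ matrix obtained by deleting the last row and the last column from the $n\times n$ matrix whose diagonal entries are the degrees of the vertices and whose off-diagonal entry in position $(i,j)$ is minus the number of edges joining the $i$-th and $j$-th vertices. Then $K$ has all diagonal entries equal to $n-1$ and all off-diagonal entries equal to $-1$, and \[ \tau(\Pi_n)=\det K=n^{n-2}. \] (For $n=1$ the matrix $K$ is empty, with determinant $1$, and $n^{n-2}=1^{-1}=1$.) -/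

import Mathlib

/-- The number `τ(G)` of spanning trees of `G`: the number of subgraphs of `G` on the whole vertex
set that are trees (connected and without cycles). -/
noncomputable def numSpanningTrees {V : Type*} (G : SimpleGraph V) : ℕ :=
  {T : SimpleGraph V | T ≤ G ∧ T.IsTree}.ncard

/-- The Kirchhoff minor of a graph whose vertices are numbered by `e`: the matrix with the degrees
of the vertices on the diagonal and the negated entries of the adjacency matrix off the diagonal,
with its last row and last column deleted. -/
def kirchhoffMinor {V : Type*} [Fintype V] [DecidableEq V] (G : SimpleGraph V)
    [DecidableRel G.Adj] {n : ℕ} (e : Fin n ≃ V) : Matrix (Fin (n - 1)) (Fin (n - 1)) ℤ :=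
  (G.lapMatrix ℤ).submatrix (fun i => e (i.castLE (Nat.sub_le n 1)))
    (fun j => e (j.castLE (Nat.sub_le n 1)))

/-!
Fix a root `r` of `G`. Pointing every vertex towards `r` turns a spanning tree into a function `f`
with `f r = r` all of whose orbits reach `r`, and the tree is recovered by joining each `v` to
`f v`. On the determinant side, replace the row of `r` in the Laplacian by a unit vector, which
turns the determinant into the cofactor at `r`. For `v ≠ r` the row of `v` is the sum of
`single v 1 - single w 1` over the neighbours `w` of `v`, so multilinearity expands the cofactor as
a sum, over all choices `f` of one neighbour per vertex, of the determinants of matrices with rows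
`single v 1 - single (f v) 1`. If all orbits of `f` reach `r`, that matrix is unitriangular once the
vertices are ordered by their height above `r`. Otherwise the indicator of the vertices that never
reach `r` lies in its kernel. Hence the cofactor counts the spanning trees. For the complete graph
the minor is `n` times the identity minus the all-ones matrix, a rank-one perturbation of a scalar.
-/

section Determinants

variable {m R : Type*} [Fintype m] [DecidableEq m] [CommRing R]

theorem det_eq_prod_diag_of_apply_eq_zero {α : Type*} [LinearOrder α] {M : Matrix m m R}
    (d : m → α) (hM : ∀ i j, i ≠ j → d i ≤ d j → M i j = 0) : M.det = ∏ i, M i i := by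
  have htri : M.BlockTriangular (OrderDual.toDual ∘ d) := fun i j hij =>
    hM i j (fun h => hij.ne (congrArg _ h.symm)) (OrderDual.toDual_lt_toDual.1 hij).le
  have hblock : ∀ a, M.toSquareBlock (OrderDual.toDual ∘ d) a =
      Matrix.diagonal fun i => M i.1 i.1 := by
    intro a
    ext ⟨i, hi⟩ ⟨j, hj⟩
    by_cases hij : i = j
    · subst hij
      simp [Matrix.toSquareBlock_def]
    · have hle : d i ≤ d j := (OrderDual.toDual.injective (hi.trans hj.symm)).le
      simp [Matrix.toSquareBlock_def, hij, hM i j hij hle]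
  simp only [htri.det, hblock, Matrix.det_diagonal]
  rw [← Finset.prod_fiberwise_of_maps_to
    (fun i _ => Finset.mem_image_of_mem (OrderDual.toDual ∘ d) (Finset.mem_univ i))]
  exact Finset.prod_congr rfl fun a _ =>
    (Finset.prod_subtype _ (fun i => by simp) fun i => M i i).symm

theorem det_scalar_sub_vecMulVec (c : R) (u v : m → R) :
    (Matrix.scalar m c - Matrix.vecMulVec u v).det =
      c ^ Fintype.card m - u ⬝ᵥ v * c ^ (Fintype.card m - 1) := by
  rw [← Matrix.eval_charpoly, Matrix.charpoly_vecMulVec]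
  simp

theorem det_submatrix_succAbove_eq_adjugate {k : ℕ} (M : Matrix m m R) (e : Fin (k + 1) ≃ m)
    (i : Fin (k + 1)) :
    (M.submatrix (e ∘ i.succAbove) (e ∘ i.succAbove)).det = M.adjugate (e i) (e i) := by
  have hcofactor := Matrix.adjugate_fin_succ_eq_det_submatrix (M.submatrix e e) i i
  rw [Even.neg_one_pow ⟨_, rfl⟩, one_mul, Matrix.adjugate_submatrix_equiv_self,
    Matrix.submatrix_apply, Matrix.submatrix_submatrix] at hcofactor
  exact hcofactor.symm

end Determinants

/-- `f` is a parent function rooted at `r`: it fixes `r`, and iterating it leads from every vertex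
to `r`. These functions encode the trees on `V`, each non-root vertex being sent to its neighbour
on the way to `r`. -/
structure IsParentFunction {V : Type*} (r : V) (f : V → V) : Prop where
  map_root : f r = r
  exists_iterate_eq : ∀ v, ∃ k, f^[k] v = r

/-- The graph joining every vertex to its image under `f`; fixed points of `f` give no edge. -/
def parentGraph {V : Type*} (f : V → V) : SimpleGraph V :=
  SimpleGraph.fromRel fun u v => f u = v

section ParentFunctions

variable {V : Type*} {r : V} {f g : V → V} {G : SimpleGraph V}

theorem parentGraph_adj {u v : V} : (parentGraph f).Adj u v ↔ u ≠ v ∧ (f u = v ∨ f v = u) :=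
  SimpleGraph.fromRel_adj _ _ _

theorem parentGraph_le_iff : parentGraph f ≤ G ↔ ∀ v, f v ≠ v → G.Adj v (f v) := by
  constructor
  · exact fun hle v hv => hle (parentGraph_adj.2 ⟨hv.symm, Or.inl rfl⟩)
  · intro hG u v huv
    obtain ⟨hne, rfl | rfl⟩ := parentGraph_adj.1 huv
    · exact hG u hne.symm
    · exact (hG v hne).symm

theorem parentGraph_reachable_iterate (f : V → V) (k : ℕ) (v : V) :
    (parentGraph f).Reachable v (f^[k] v) := by
  induction k with
  | zero => rfl
  | succ k ih =>
    rw [Function.iterate_succ_apply']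
    refine ih.trans ?_
    by_cases hfix : f^[k] v = f (f^[k] v)
    · rw [← hfix]
    · exact (parentGraph_adj.2 ⟨hfix, Or.inl rfl⟩).reachable

theorem exists_iterate_eq_of_reachable_deleteEdges {u v : V}
    (huv : ((parentGraph f).deleteEdges {s(v, f v)}).Reachable v u) : ∃ k, f^[k] u = v := by
  rw [SimpleGraph.reachable_iff_reflTransGen] at huv
  induction huv with
  | refl => exact ⟨0, rfl⟩
  | @tail u w _ hadj ih =>
    obtain ⟨k, hk⟩ := ih
    rw [SimpleGraph.deleteEdges_adj, parentGraph_adj, Set.mem_singleton_iff] at hadj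
    obtain ⟨⟨-, rfl | rfl⟩, hdeleted⟩ := hadj
    · cases k with
      | zero => exact absurd (by rw [← hk]; rfl) hdeleted
      | succ k => exact ⟨k, hk⟩
    · exact ⟨k + 1, hk⟩

namespace IsParentFunction

theorem of_height (hr : f r = r) (d : V → ℕ) (hd : ∀ v, v ≠ r → d (f v) < d v) :
    IsParentFunction r f := by
  refine ⟨hr, fun v => ?_⟩
  induction hv : d v using Nat.strong_induction_on generalizing v with
  | _ _ ih =>
    by_cases hvr : v = r
    · exact ⟨0, hvr⟩
    · obtain ⟨k, hk⟩ := ih _ (hv ▸ hd v hvr) (f v) rfl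
      exact ⟨k + 1, hk⟩

theorem exists_height (hf : IsParentFunction r f) :
    ∃ d : V → ℕ, ∀ v, v ≠ r → d (f v) < d v := by
  classical
  let d : V → ℕ := fun v => Nat.find (hf.exists_iterate_eq v)
  refine ⟨d, fun v hv => ?_⟩
  have hspec : f^[d v] v = r := Nat.find_spec (hf.exists_iterate_eq v)
  cases hk : d v with
  | zero => exact absurd (by rwa [hk] at hspec) hv
  | succ k =>
    rw [hk] at hspec
    exact Nat.lt_succ_of_le (Nat.find_min' (hf.exists_iterate_eq (f v)) hspec)

theorem eq_root_of_isPeriodicPt (hf : IsParentFunction r f) {n : ℕ} {v : V} (hn : 0 < n)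
    (hv : Function.IsPeriodicPt f n v) : v = r := by
  obtain ⟨k, hk⟩ := hf.exists_iterate_eq v
  calc v = f^[n * k] v := (hv.mul_const k).eq.symm
    _ = f^[n * k - k] (f^[k] v) := by
      rw [← Function.iterate_add_apply, Nat.sub_add_cancel (Nat.le_mul_of_pos_left k hn)]
    _ = r := by rw [hk, Function.iterate_fixed hf.map_root]

theorem map_eq_self_iff (hf : IsParentFunction r f) {v : V} : f v = v ↔ v = r :=
  ⟨fun hv => hf.eq_root_of_isPeriodicPt one_pos hv, fun hv => hv ▸ hf.map_root⟩

theorem parentGraph_le_iff (hf : IsParentFunction r f) :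
    parentGraph f ≤ G ↔ ∀ v, v ≠ r → G.Adj v (f v) := by
  simp only [_root_.parentGraph_le_iff, ne_eq, hf.map_eq_self_iff]

theorem parentGraph_connected (hf : IsParentFunction r f) : (parentGraph f).Connected := by
  have hroot : ∀ v, (parentGraph f).Reachable v r := fun v => by
    obtain ⟨k, hk⟩ := hf.exists_iterate_eq v
    exact hk ▸ parentGraph_reachable_iterate f k v
  have : Nonempty V := ⟨r⟩
  exact ⟨fun u v => (hroot u).trans (hroot v).symm⟩

theorem parentGraph_isAcyclic (hf : IsParentFunction r f) : (parentGraph f).IsAcyclic := by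
  have hbridge : ∀ v, v ≠ f v → (parentGraph f).IsBridge s(v, f v) := by
    intro v hv
    rw [SimpleGraph.isBridge_iff]
    intro hreach
    obtain ⟨k, hk⟩ := exists_iterate_eq_of_reachable_deleteEdges hreach
    have hvr : v = r := hf.eq_root_of_isPeriodicPt k.succ_pos hk
    exact hv (hf.map_eq_self_iff.2 hvr).symm
  rw [SimpleGraph.isAcyclic_iff_forall_adj_isBridge]
  intro u v huv
  obtain ⟨hne, rfl | rfl⟩ := parentGraph_adj.1 huv
  · exact hbridge u hne
  · exact Sym2.eq_swap ▸ hbridge v hne.symm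

theorem parentGraph_isTree (hf : IsParentFunction r f) : (parentGraph f).IsTree :=
  ⟨hf.parentGraph_connected, hf.parentGraph_isAcyclic⟩

theorem eq_of_parentGraph_eq (hf : IsParentFunction r f) (hg : IsParentFunction r g)
    (hfg : parentGraph f = parentGraph g) : f = g := by
  have heq : ∀ k v, g^[k] v = r → f v = g v := by
    intro k
    induction k with
    | zero =>
      rintro v rfl
      exact hf.map_root.trans hg.map_root.symm
    | succ k ih =>
      intro v hv
      by_cases hvr : v = r
      · rw [hvr, hf.map_root, hg.map_root]
      have hadj : (parentGraph f).Adj v (g v) := by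
        rw [hfg, parentGraph_adj]
        exact ⟨fun h => hvr (hg.map_eq_self_iff.1 h.symm), Or.inl rfl⟩
      rcases (parentGraph_adj.1 hadj).2 with h | h
      · exact h
      · have hperiod : g (g v) = v := (ih (g v) hv).symm.trans h
        exact absurd (hg.eq_root_of_isPeriodicPt two_pos hperiod) hvr
  funext v
  obtain ⟨k, hk⟩ := hg.exists_iterate_eq v
  exact heq k v hk

end IsParentFunction

theorem exists_adj_dist_lt_of_reachable {u v : V} (huv : G.Reachable u v) (hne : u ≠ v) :
    ∃ w, G.Adj u w ∧ G.dist w v < G.dist u v := by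
  obtain ⟨p, hp⟩ := huv.exists_walk_length_eq_dist
  cases p with
  | nil => exact absurd rfl hne
  | cons hadj q => exact ⟨_, hadj, (SimpleGraph.dist_le q).trans_lt (hp ▸ q.length.lt_succ_self)⟩

theorem exists_isParentFunction_parentGraph_le (hG : G.Connected) (r : V) :
    ∃ f, IsParentFunction r f ∧ parentGraph f ≤ G := by
  classical
  choose! f hadj hdist using fun v (hv : v ≠ r) =>
    exists_adj_dist_lt_of_reachable (hG.preconnected v r) hv
  have hf : IsParentFunction r (Function.update f r r) :=
    .of_height (Function.update_self ..) (G.dist · r) fun v hv => by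
      simpa only [Function.update_of_ne hv] using hdist v hv
  refine ⟨_, hf, hf.parentGraph_le_iff.2 fun v hv => ?_⟩
  simpa only [Function.update_of_ne hv] using hadj v hv

theorem bijOn_parentGraph (r : V) :
    Set.BijOn parentGraph {f | IsParentFunction r f} {T | T.IsTree} := by
  refine ⟨fun f hf => hf.parentGraph_isTree, fun f hf g hg => hf.eq_of_parentGraph_eq hg, ?_⟩
  intro T hT
  obtain ⟨f, hf, hle⟩ := exists_isParentFunction_parentGraph_le hT.connected r
  have hmin : Minimal SimpleGraph.Connected T := SimpleGraph.isTree_iff_minimal_connected.1 hT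
  exact ⟨f, hf, hle.antisymm (hmin.2 hf.parentGraph_connected hle)⟩

theorem numSpanningTrees_eq_ncard_isParentFunction (G : SimpleGraph V) (r : V) :
    numSpanningTrees G = {f | IsParentFunction r f ∧ ∀ v, v ≠ r → G.Adj v (f v)}.ncard := by
  have hbij := bijOn_parentGraph r
  refine (Set.ncard_congr (fun f _ => parentGraph f) ?_ ?_ ?_).symm
  · exact fun f hf => ⟨hf.1.parentGraph_le_iff.2 hf.2, hbij.mapsTo hf.1⟩
  · exact fun f g hf hg => hbij.injOn hf.1 hg.1
  · rintro T ⟨hle, hT⟩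
    obtain ⟨f, hf, rfl⟩ := hbij.surjOn hT
    exact ⟨f, ⟨hf, hf.parentGraph_le_iff.1 hle⟩, rfl⟩

end ParentFunctions

section MatrixTree

variable {V : Type*} [DecidableEq V] (R : Type*) [CommRing R] {r : V} {f : V → V}

/-- The contribution of the edge from `v` to `w` to the row of `v` in the Laplacian; at the root it
is the unit vector, whatever `w`. -/
def parentRow (r v w : V) : V → R :=
  Pi.single v 1 - if v = r then 0 else Pi.single w 1

/-- The matrix with the row `parentRow R r v (f v)` at each vertex `v`: the summand of the root
cofactor of the Laplacian that belongs to the choice `f` of a neighbour for every vertex. -/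
def parentMatrix (r : V) (f : V → V) : Matrix V V R :=
  Matrix.of fun v => parentRow R r v (f v)

theorem parentMatrix_apply (r : V) (f : V → V) (v w : V) :
    parentMatrix R r f v w = (if v = w then 1 else 0) - if v ≠ r ∧ f v = w then 1 else 0 := by
  by_cases hv : v = r <;> simp [parentMatrix, parentRow, hv, Pi.single_apply, eq_comm (a := w)]

variable [Fintype V]

theorem parentMatrix_mulVec (r : V) (f : V → V) (x : V → R) (v : V) :
    (parentMatrix R r f).mulVec x v = x v - if v = r then 0 else x (f v) := by
  by_cases hv : v = r <;>
    simp [Matrix.mulVec, dotProduct, parentMatrix_apply, hv, sub_mul, Finset.sum_sub_distrib]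

theorem IsParentFunction.det_parentMatrix (hf : IsParentFunction r f) :
    (parentMatrix R r f).det = 1 := by
  obtain ⟨d, hd⟩ := hf.exists_height
  have hoff : ∀ v w, d v ≤ d w → ¬ (v ≠ r ∧ f v = w) := by
    rintro v _ hle ⟨hv, rfl⟩
    exact hle.not_gt (hd v hv)
  rw [det_eq_prod_diag_of_apply_eq_zero d fun v w hne hle => by
    rw [parentMatrix_apply, if_neg hne, if_neg (hoff v w hle), sub_zero]]
  refine Finset.prod_eq_one fun v _ => ?_
  rw [parentMatrix_apply, if_pos rfl, if_neg (hoff v v le_rfl), sub_zero]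

theorem det_parentMatrix_eq_zero {v : V} (hv : ∀ k, f^[k] v ≠ r) :
    (parentMatrix R r f).det = 0 := by
  classical
  let x : V → R := fun w => if ∃ k, f^[k] w = r then 0 else 1
  have hroot : x r = 0 := if_pos ⟨0, rfl⟩
  have hstep : ∀ w, w ≠ r → x (f w) = x w := by
    intro w hw
    have hiff : (∃ k, f^[k] (f w) = r) ↔ ∃ k, f^[k] w = r := by
      refine ⟨fun ⟨k, hk⟩ => ⟨k + 1, hk⟩, ?_⟩
      rintro ⟨_ | k, hk⟩
      · exact absurd hk hw
      · exact ⟨k, hk⟩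
    simp only [x, hiff]
  have hker : (parentMatrix R r f).mulVec x = 0 := by
    funext w
    rw [parentMatrix_mulVec]
    by_cases hw : w = r
    · simp [hw, hroot]
    · simp [hw, hstep w hw]
  have hxv : x v = 1 := if_neg (not_exists.2 hv)
  exact Matrix.det_eq_zero_of_mulVec_eq_zero_of_mem_nonZeroDivisors hker
    (i := v) (hxv ▸ one_mem _)

open Classical in
theorem det_parentMatrix (hr : f r = r) :
    (parentMatrix R r f).det = if IsParentFunction r f then 1 else 0 := by
  split_ifs with hf
  · exact hf.det_parentMatrix R
  · obtain ⟨v, hv⟩ : ∃ v, ∀ k, f^[k] v ≠ r := by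
      by_contra! hreach
      exact hf ⟨hr, hreach⟩
    exact det_parentMatrix_eq_zero R hv

variable (G : SimpleGraph V) [DecidableRel G.Adj]

/-- The values at `v` that a parent function rooted at `r` with edges in `G` may take. -/
def parentChoices (r v : V) : Finset V :=
  if v = r then {r} else G.neighborFinset v

theorem mem_piFinset_parentChoices :
    f ∈ Fintype.piFinset (parentChoices G r) ↔ f r = r ∧ ∀ v, v ≠ r → G.Adj v (f v) := by
  rw [Fintype.mem_piFinset]
  refine ⟨fun h => ⟨by simpa [parentChoices] using h r, fun v hv => ?_⟩, fun h v => ?_⟩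
  · simpa [parentChoices, hv] using h v
  · by_cases hv : v = r
    · simp [parentChoices, hv, h.1]
    · simpa [parentChoices, hv] using h.2 v hv

theorem lapMatrix_updateRow_root (r : V) :
    (G.lapMatrix R).updateRow r (Pi.single r 1) =
      fun v => ∑ w ∈ parentChoices G r v, parentRow R r v w := by
  funext v w
  by_cases hv : v = r
  · subst hv
    simp [parentChoices, parentRow]
  · simp [parentChoices, parentRow, hv, SimpleGraph.lapMatrix, SimpleGraph.degMatrix,
      Matrix.diagonal_apply, Pi.single_apply, SimpleGraph.adjMatrix_apply, eq_comm (a := w)]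

theorem adjugate_lapMatrix_eq_sum_det_parentMatrix (r : V) :
    (G.lapMatrix R).adjugate r r =
      ∑ f ∈ Fintype.piFinset (parentChoices G r), (parentMatrix R r f).det := by
  rw [Matrix.adjugate_apply, lapMatrix_updateRow_root]
  exact Matrix.detRowAlternating.toMultilinearMap.map_sum_finset (parentRow R r) (parentChoices G r)

theorem numSpanningTrees_eq_adjugate_lapMatrix (r : V) :
    (numSpanningTrees G : R) = (G.lapMatrix R).adjugate r r := by
  classical
  rw [adjugate_lapMatrix_eq_sum_det_parentMatrix, Finset.sum_congr rfl fun f hf =>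
      det_parentMatrix R ((mem_piFinset_parentChoices G).1 hf).1,
    Finset.sum_boole, numSpanningTrees_eq_ncard_isParentFunction G r, ← Set.ncard_coe_finset]
  congr 2
  ext f
  simp only [Set.mem_ofPred_eq, Finset.coe_filter, mem_piFinset_parentChoices]
  exact ⟨fun h => ⟨⟨h.1.map_root, h.2⟩, h.1⟩, fun h => ⟨h.2, h.1.2⟩⟩

theorem numSpanningTrees_eq_det_kirchhoffMinor {n : ℕ} (hn : 1 ≤ n) (e : Fin n ≃ V) :
    (numSpanningTrees G : ℤ) = (kirchhoffMinor G e).det := by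
  obtain ⟨m, rfl⟩ := Nat.exists_eq_add_of_le' hn
  rw [numSpanningTrees_eq_adjugate_lapMatrix ℤ G (e (Fin.last m)),
    ← det_submatrix_succAbove_eq_adjugate, Fin.succAbove_last]
  rfl

end MatrixTree

section CompleteGraph

variable {V : Type*} [Fintype V] [DecidableEq V] {n : ℕ}

theorem kirchhoffMinor_top (e : Fin n ≃ V) :
    kirchhoffMinor (⊤ : SimpleGraph V) e =
      Matrix.of (fun i j => if i = j then (n : ℤ) - 1 else -1) := by
  ext i j
  have hcard : Fintype.card V = n := by rw [← Fintype.card_congr e, Fintype.card_fin]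
  have hn : 1 ≤ n := by have := i.2; omega
  by_cases hij : i = j
  · subst hij
    simp [kirchhoffMinor, SimpleGraph.lapMatrix, SimpleGraph.degMatrix, hcard, hn]
  · simp [kirchhoffMinor, SimpleGraph.lapMatrix, SimpleGraph.degMatrix, hij]

theorem kirchhoffMinor_top_eq_scalar_sub_vecMulVec (e : Fin n ≃ V) :
    kirchhoffMinor (⊤ : SimpleGraph V) e =
      Matrix.scalar (Fin (n - 1)) (n : ℤ) - Matrix.vecMulVec 1 1 := by
  rw [kirchhoffMinor_top]
  ext i j
  rw [Matrix.sub_apply, Matrix.scalar_apply, Matrix.diagonal_apply, Matrix.vecMulVec_apply,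
    Matrix.of_apply]
  split_ifs <;> simp

theorem det_kirchhoffMinor_top (hn : 1 ≤ n) (e : Fin n ≃ V) :
    ((kirchhoffMinor (⊤ : SimpleGraph V) e).det : ℚ) = (n : ℚ) ^ ((n : ℤ) - 2) := by
  rw [kirchhoffMinor_top_eq_scalar_sub_vecMulVec, det_scalar_sub_vecMulVec, one_dotProduct_one,
    Fintype.card_fin]
  obtain rfl | ⟨k, rfl⟩ : n = 1 ∨ ∃ k, n = k + 2 := by
    obtain rfl | hn := hn.eq_or_lt
    · exact Or.inl rfl
    · exact Or.inr (Nat.exists_eq_add_of_le' hn)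
  · simp
  · have hexp : ((k + 2 : ℕ) : ℤ) - 2 = k := by simp
    simp only [hexp, zpow_natCast, Nat.add_succ_sub_one]
    push_cast
    ring

end CompleteGraph

theorem mainTheorem3 {V : Type*} [Fintype V] [DecidableEq V] (n : ℕ) (hn : 1 ≤ n)
    (e : Fin n ≃ V) :
    kirchhoffMinor (⊤ : SimpleGraph V) e
        = Matrix.of (fun i j => if i = j then (n : ℤ) - 1 else -1) ∧
      (numSpanningTrees (⊤ : SimpleGraph V) : ℤ) = (kirchhoffMinor (⊤ : SimpleGraph V) e).det ∧
      ((kirchhoffMinor (⊤ : SimpleGraph V) e).det : ℚ) = (n : ℚ) ^ ((n : ℤ) - 2) ∧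
      (numSpanningTrees (⊤ : SimpleGraph V) : ℚ) = (n : ℚ) ^ ((n : ℤ) - 2) := by
  have htree := numSpanningTrees_eq_det_kirchhoffMinor (⊤ : SimpleGraph V) hn e
  have hdet := det_kirchhoffMinor_top hn e
  exact ⟨kirchhoffMinor_top e, htree, hdet, by rw [← hdet, ← htree, Int.cast_natCast]⟩
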